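/- Let $X$ be a compact metric space and $\phi : X \to X$ a homeomorphism. Let $x_1, \dots, x_q \in X$ be finitely many points which are not periodic under $\phi$ and whose orbits $\{\phi^n(x_p) : n \in \mathbb Z\}$ are pairwise disjoint. For each $1 \le p \le q$ let $\beta_p < 0$ and let $J_p$ be one of the intervals $(-\infty, \beta_p]$ and $(-\infty, \beta_p)$. Then there is a continuous function $F : X \to \mathbb R$ such that the following two statements hold. (a) For every $p \in \{1, \dots, q\}$ and every $\beta \in \mathbb R$, there is an $e^{\beta F}$-conformal measure concentrated on the $\phi$-orbit of $x_p$ if and only if $\beta \in J_p$. Here an $e^{\beta F}$-conformal measure is a Borel probability measure $m$ on $X$ with $m(\phi(B)) = \int_B e^{\beta F} \, \mathrm{d}m$ for all Borel sets $B \subseteq X$. (b) The flow $\alpha^F$ is approximately inner. Here $C(X) \rtimes_\phi \mathbb Z$ is the universal $C^*$-algebra generated by a copy of $C(X)$ and a unitary $U$ with $U f U^* = f \circ \phi^{-1}$ for all $f \in C(X)$, and $\alpha^F = (\alpha^F_t)_{t \in \mathbb R}$ is the continuous one-parameter group of automorphisms of $C(X) \rtimes_\phi \mathbb Z$ determined by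 $\alpha^F_t(fU) = f U e^{-itF}$ for $f \in C(X)$. A flow $\alpha$ on a unital $C^*$-algebra $A$ is inner if there is a self-adjoint $h \in A$ with $\alpha_t(a) = e^{ith} a e^{-ith}$ for all $t \in \mathbb R$ and $a \in A$. It is approximately inner if there is a sequence $(\alpha^n)$ of inner flows on $A$ such that, for every $a \in A$, $\|\alpha_t(a) - \alpha^n_t(a)\| \to 0$ as $n \to \infty$, uniformly for $t$ in compact subsets of $\mathbb R$. -/

import Mathlib

open scoped ENNReal CStarAlgebra

universe u v

noncomputable section

/-! ## Orbits and conformal measures -/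

/-- The two-sided orbit of `x` under the homeomorphism `φ`. -/
def homeoOrbit {X : Type u} [TopologicalSpace X] (φ : X ≃ₜ X) (x : X) : Set X :=
  Set.range fun n : ℤ => (φ ^ n) x

/-- `m` is an `e^{βF}`-conformal measure for `φ`: a Borel probability measure such that
`m(φ(B)) = ∫_B e^{βF} dm` for all Borel sets `B`. -/
def IsConformalMeasure {X : Type u} [TopologicalSpace X] [MeasurableSpace X] (φ : X ≃ₜ X)
    (F : C(X, ℝ)) (β : ℝ) (m : MeasureTheory.Measure X) : Prop :=
  MeasureTheory.IsProbabilityMeasure m ∧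
    ∀ B : Set X, MeasurableSet B →
      m (φ '' B) = ∫⁻ x in B, ENNReal.ofReal (Real.exp (β * F x)) ∂m

/-- `m` is concentrated on `S`: the complement of `S` is a null set. -/
def IsConcentratedOn {X : Type u} [MeasurableSpace X] (m : MeasureTheory.Measure X)
    (S : Set X) : Prop :=
  m Sᶜ = 0

/-! ## Flows on unital C*-algebras -/

/-- A flow on `A`: a strongly continuous one-parameter group of *-automorphisms. (Each `α_t` is
invertible with inverse `α_{-t}`, by the group law.) -/
structure CStarFlow (A : Type v) [CStarAlgebra A] where
  toFun : ℝ → A →⋆ₐ[ℂ] A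
  map_zero : toFun 0 = StarAlgHom.id ℂ A
  map_add : ∀ s t, toFun (s + t) = (toFun s).comp (toFun t)
  continuous : ∀ a, Continuous fun t => toFun t a

/-- The flow is inner: `α_t(a) = e^{ith} a e^{-ith}` for some self-adjoint `h ∈ A`. -/
def CStarFlow.IsInner {A : Type v} [CStarAlgebra A] (α : CStarFlow A) : Prop :=
  ∃ h : A, IsSelfAdjoint h ∧ ∀ (t : ℝ) (a : A),
    α.toFun t a = NormedSpace.exp ((Complex.I * t) • h) * a *
      NormedSpace.exp (-((Complex.I * t) • h))

/-- The flow is approximately inner: there are inner flows `α^n` such that, for every `a ∈ A`,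
`‖α_t(a) - α^n_t(a)‖ → 0` uniformly for `t` in compact subsets of `ℝ`. -/
def CStarFlow.IsApproximatelyInner {A : Type v} [CStarAlgebra A] (α : CStarFlow A) : Prop :=
  ∃ αs : ℕ → CStarFlow A, (∀ n, (αs n).IsInner) ∧
    ∀ (a : A) (K : Set ℝ), IsCompact K →
      TendstoUniformlyOn (fun n t => (αs n).toFun t a) (fun t => α.toFun t a) Filter.atTop K

/-! ## The crossed product `C(X) ⋊_φ ℤ`

The universal C*-algebra generated by a copy of `C(X)` and a unitary `U` with
`U f U* = f ∘ φ⁻¹` is constructed as the C*-algebra generated by the images of `C(X)` and of `U`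
in the product of all covariant representations of `(X, φ)` in C*-algebras. -/

/-- A covariant representation of `(X, φ)` in a unital C*-algebra `B`: a unital *-homomorphism
`π : C(X) → B` and a unitary `V ∈ B` with `V π(f) V* = π(f ∘ φ⁻¹)`.
It is enough to let `B` range over the universe of `X`: a C*-algebra (in any universe) which is
generated by an image of `C(X)` and one unitary is the closure of an image of a set in the universe
of `X`, and hence isomorphic to a C*-algebra in that universe. The zero algebra is left out because
it does not contribute to the universal norm. -/
structure CovariantRep {X : Type u} [TopologicalSpace X] [CompactSpace X] (φ : X ≃ₜ X) :
    Type (u + 1) where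
  B : Type u
  [cstar : CStarAlgebra B]
  [nontriv : Nontrivial B]
  π : C(X, ℂ) →⋆ₐ[ℂ] B
  V : unitary B
  covariant : ∀ f : C(X, ℂ), (V : B) * π f * star (V : B) = π (f.comp (φ.symm : C(X, X)))

attribute [instance] CovariantRep.cstar CovariantRep.nontriv

/-- The C*-algebra of bounded families `(a_r)`, `r` a covariant representation, `a_r ∈ B_r`. -/
abbrev RepProd {X : Type u} [TopologicalSpace X] [CompactSpace X] (φ : X ≃ₜ X) : Type (u + 1) :=
  lp (fun r : CovariantRep φ => r.B) ∞

instance {X : Type u} [TopologicalSpace X] [CompactSpace X] (φ : X ≃ₜ X) :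
    CStarAlgebra (RepProd φ) where

/-- `f ↦ (π_r(f))_r`. -/
def RepProd.ofFun {X : Type u} [TopologicalSpace X] [CompactSpace X] (φ : X ≃ₜ X) :
    C(X, ℂ) →⋆ₐ[ℂ] RepProd φ where
  toFun f := ⟨fun r => r.π f, memℓp_infty ⟨‖f‖, by
    rintro _ ⟨r, rfl⟩
    exact NonUnitalStarAlgHom.norm_apply_le r.π f⟩⟩
  map_one' := by ext r; simp
  map_mul' f g := by ext r; simp
  map_zero' := by ext r; simp
  map_add' f g := by ext r; simp; rfl
  commutes' c := by ext r; simp [AlgHomClass.commutes]; rfl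
  map_star' f := by ext r; simp [map_star]

/-- The family `(V_r)_r`. -/
def RepProd.ofUnitary {X : Type u} [TopologicalSpace X] [CompactSpace X] (φ : X ≃ₜ X) :
    RepProd φ :=
  ⟨fun r => (r.V : r.B), memℓp_infty ⟨1, by
    rintro _ ⟨r, rfl⟩
    exact (CStarRing.norm_coe_unitary r.V).le⟩⟩

/-- The closed *-subalgebra generated by the images of `C(X)` and `U`. -/
def CrossedProduct.subalgebra {X : Type u} [TopologicalSpace X] [CompactSpace X] (φ : X ≃ₜ X) :
    StarSubalgebra ℂ (RepProd φ) :=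
  (StarAlgebra.adjoin ℂ
    (Set.range (RepProd.ofFun φ) ∪ {RepProd.ofUnitary φ})).topologicalClosure

theorem CrossedProduct.isClosed_subalgebra {X : Type u} [TopologicalSpace X] [CompactSpace X]
    (φ : X ≃ₜ X) : IsClosed (CrossedProduct.subalgebra φ : Set (RepProd φ)) :=
  StarSubalgebra.isClosed_topologicalClosure _

/-- The crossed product C*-algebra `C(X) ⋊_φ ℤ`. -/
abbrev CrossedProduct {X : Type u} [TopologicalSpace X] [CompactSpace X] (φ : X ≃ₜ X) :
    Type (u + 1) :=
  CrossedProduct.subalgebra φ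

instance {X : Type u} [TopologicalSpace X] [CompactSpace X] (φ : X ≃ₜ X) :
    CStarAlgebra (CrossedProduct φ) :=
  StarSubalgebra.cstarAlgebra _ (h_closed := CrossedProduct.isClosed_subalgebra φ)

theorem CrossedProduct.ofFun_mem {X : Type u} [TopologicalSpace X] [CompactSpace X]
    (φ : X ≃ₜ X) (f : C(X, ℂ)) : RepProd.ofFun φ f ∈ CrossedProduct.subalgebra φ :=
  StarSubalgebra.le_topologicalClosure _
    (StarAlgebra.subset_adjoin ℂ _ (Or.inl ⟨f, rfl⟩))

theorem CrossedProduct.ofUnitary_mem {X : Type u} [TopologicalSpace X] [CompactSpace X]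
    (φ : X ≃ₜ X) : RepProd.ofUnitary φ ∈ CrossedProduct.subalgebra φ :=
  StarSubalgebra.le_topologicalClosure _
    (StarAlgebra.subset_adjoin ℂ _ (Or.inr rfl))

/-- The canonical copy of `C(X)` in the crossed product. -/
def CrossedProduct.ι {X : Type u} [TopologicalSpace X] [CompactSpace X] (φ : X ≃ₜ X) :
    C(X, ℂ) →⋆ₐ[ℂ] CrossedProduct φ :=
  (RepProd.ofFun φ).codRestrict (CrossedProduct.subalgebra φ) (CrossedProduct.ofFun_mem φ)

/-- The canonical unitary `U` of the crossed product. -/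
def CrossedProduct.U {X : Type u} [TopologicalSpace X] [CompactSpace X] (φ : X ≃ₜ X) :
    CrossedProduct φ :=
  ⟨RepProd.ofUnitary φ, CrossedProduct.ofUnitary_mem φ⟩

theorem CrossedProduct.U_mem_unitary {X : Type u} [TopologicalSpace X] [CompactSpace X]
    (φ : X ≃ₜ X) : CrossedProduct.U φ ∈ unitary (CrossedProduct φ) := by
  rw [Unitary.mem_iff]
  constructor
  · apply Subtype.ext
    ext r
    exact (Unitary.mem_iff.1 r.V.2).1
  · apply Subtype.ext
    ext r
    exact (Unitary.mem_iff.1 r.V.2).2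

/-- The covariance relation `U f U* = f ∘ φ⁻¹`. -/
theorem CrossedProduct.covariance {X : Type u} [TopologicalSpace X] [CompactSpace X]
    (φ : X ≃ₜ X) (f : C(X, ℂ)) :
    CrossedProduct.U φ * CrossedProduct.ι φ f * star (CrossedProduct.U φ) =
      CrossedProduct.ι φ (f.comp (φ.symm : C(X, X))) := by
  apply Subtype.ext
  ext r
  exact r.covariant f

/-- The *-homomorphism out of the crossed product given by a covariant representation. -/
def CrossedProduct.lift {X : Type u} [TopologicalSpace X] [CompactSpace X] {φ : X ≃ₜ X}
    (r : CovariantRep φ) : CrossedProduct φ →⋆ₐ[ℂ] r.B where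
  toFun a := a.1 r
  map_one' := rfl
  map_mul' _ _ := rfl
  map_zero' := rfl
  map_add' _ _ := rfl
  commutes' _ := rfl
  map_star' _ := rfl

theorem CrossedProduct.lift_ι {X : Type u} [TopologicalSpace X] [CompactSpace X] {φ : X ≃ₜ X}
    (r : CovariantRep φ) (f : C(X, ℂ)) :
    CrossedProduct.lift r (CrossedProduct.ι φ f) = r.π f := rfl

theorem CrossedProduct.lift_U {X : Type u} [TopologicalSpace X] [CompactSpace X] {φ : X ≃ₜ X}
    (r : CovariantRep φ) : CrossedProduct.lift r (CrossedProduct.U φ) = r.V := rfl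

/-! ## The flow `α^F` -/

/-- The function `e^{-itF} ∈ C(X)`. -/
def phaseFun {X : Type u} [TopologicalSpace X] (F : C(X, ℝ)) (t : ℝ) : C(X, ℂ) where
  toFun x := Complex.exp (-(Complex.I * t * F x))
  continuous_toFun := by fun_prop

theorem star_phaseFun {X : Type u} [TopologicalSpace X] (F : C(X, ℝ)) (t : ℝ) :
    star (phaseFun F t) = phaseFun F (-t) := by
  ext x
  simp [phaseFun, ← Complex.exp_conj]

theorem phaseFun_zero {X : Type u} [TopologicalSpace X] (F : C(X, ℝ)) :
    phaseFun F 0 = 1 := by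
  ext x
  simp [phaseFun]

theorem phaseFun_add {X : Type u} [TopologicalSpace X] (F : C(X, ℝ)) (s t : ℝ) :
    phaseFun F (s + t) = phaseFun F s * phaseFun F t := by
  ext x
  simp only [phaseFun, ContinuousMap.coe_mk, ContinuousMap.mul_apply, ← Complex.exp_add]
  congr 1
  push_cast
  ring

theorem continuous_phaseFun {X : Type u} [TopologicalSpace X] (F : C(X, ℝ)) :
    Continuous (phaseFun F) := by
  apply ContinuousMap.continuous_of_continuous_uncurry
  simp only [Function.uncurry_def, phaseFun, ContinuousMap.coe_mk]
  fun_prop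

theorem phaseFun_mem_unitary {X : Type u} [TopologicalSpace X] [CompactSpace X]
    (F : C(X, ℝ)) (t : ℝ) : phaseFun F t ∈ unitary C(X, ℂ) := by
  rw [Unitary.mem_iff, star_phaseFun, ← phaseFun_add, ← phaseFun_add]
  simp [phaseFun_zero]

/-- The covariant representation `(π, V π(e^{-itF}))`. -/
@[reducible] def CovariantRep.twist {X : Type u} [TopologicalSpace X] [CompactSpace X]
    {φ : X ≃ₜ X} (F : C(X, ℝ)) (t : ℝ) (r : CovariantRep φ) : CovariantRep φ where
  B := r.B
  π := r.π
  V := r.V * ⟨r.π (phaseFun F t), Unitary.map_mem r.π (phaseFun_mem_unitary F t)⟩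
  covariant f := by
    have h : r.π (phaseFun F t) * r.π f * r.π (star (phaseFun F t)) = r.π f := by
      rw [← map_mul, ← map_mul, mul_right_comm, (Unitary.mem_iff.1 (phaseFun_mem_unitary F t)).2,
        one_mul]
    rw [← r.covariant f]
    conv_rhs => rw [← h]
    simp only [Submonoid.coe_mul, star_mul, map_star, mul_assoc]

theorem CovariantRep.twist_zero {X : Type u} [TopologicalSpace X] [CompactSpace X]
    {φ : X ≃ₜ X} (F : C(X, ℝ)) (r : CovariantRep φ) : r.twist F 0 = r := by
  cases r
  simp [CovariantRep.twist, phaseFun_zero]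

theorem CovariantRep.twist_twist {X : Type u} [TopologicalSpace X] [CompactSpace X]
    {φ : X ≃ₜ X} (F : C(X, ℝ)) (s t : ℝ) (r : CovariantRep φ) :
    (r.twist F s).twist F t = r.twist F (s + t) := by
  cases r
  simp only [CovariantRep.twist, CovariantRep.mk.injEq, heq_eq_eq, true_and]
  ext
  simp only [Submonoid.coe_mul, mul_assoc]
  rw [← map_mul, ← phaseFun_add]

/-- Reindexing along `r ↦ r.twist F t`. -/
def RepProd.twist {X : Type u} [TopologicalSpace X] [CompactSpace X] (φ : X ≃ₜ X)
    (F : C(X, ℝ)) (t : ℝ) : RepProd φ →⋆ₐ[ℂ] RepProd φ where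
  toFun a := ⟨fun r => a (r.twist F t), memℓp_infty ⟨‖a‖, by
    rintro _ ⟨r, rfl⟩
    exact lp.norm_apply_le_norm ENNReal.top_ne_zero a (r.twist F t)⟩⟩
  map_one' := rfl
  map_mul' _ _ := rfl
  map_zero' := rfl
  map_add' _ _ := rfl
  commutes' _ := rfl
  map_star' _ := rfl

theorem RepProd.twist_ofUnitary {X : Type u} [TopologicalSpace X] [CompactSpace X]
    (φ : X ≃ₜ X) (F : C(X, ℝ)) (t : ℝ) :
    RepProd.twist φ F t (RepProd.ofUnitary φ) =
      RepProd.ofUnitary φ * RepProd.ofFun φ (phaseFun F t) := rfl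

theorem RepProd.twist_mem {X : Type u} [TopologicalSpace X] [CompactSpace X] (φ : X ≃ₜ X)
    (F : C(X, ℝ)) (t : ℝ) (a : RepProd φ) (ha : a ∈ CrossedProduct.subalgebra φ) :
    RepProd.twist φ F t a ∈ CrossedProduct.subalgebra φ := by
  have hle : CrossedProduct.subalgebra φ ≤
      (CrossedProduct.subalgebra φ).comap (RepProd.twist φ F t) := by
    refine StarSubalgebra.topologicalClosure_minimal (StarAlgebra.adjoin_le ?_) ?_
    · rintro _ (⟨f, rfl⟩ | rfl)
      · exact CrossedProduct.ofFun_mem φ f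
      · exact mul_mem (CrossedProduct.ofUnitary_mem φ) (CrossedProduct.ofFun_mem φ _)
    · exact (CrossedProduct.isClosed_subalgebra φ).preimage
        (map_continuous (RepProd.twist φ F t))
  exact hle ha

theorem RepProd.continuous_twist {X : Type u} [TopologicalSpace X] [CompactSpace X] (φ : X ≃ₜ X)
    (F : C(X, ℝ)) (a : RepProd φ) (ha : a ∈ CrossedProduct.subalgebra φ) :
    Continuous fun t => RepProd.twist φ F t a := by
  have hS : ∀ b ∈ StarAlgebra.adjoin ℂ (Set.range (RepProd.ofFun φ) ∪ {RepProd.ofUnitary φ}),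
      Continuous fun t => RepProd.twist φ F t b := by
    intro b hb
    induction hb using StarAlgebra.adjoin_induction with
    | mem x hx =>
      rcases hx with ⟨f, rfl⟩ | rfl
      · exact (continuous_const : Continuous fun _ : ℝ => RepProd.ofFun φ f)
      · simp only [RepProd.twist_ofUnitary]
        exact continuous_const.mul ((map_continuous (RepProd.ofFun φ)).comp
          (continuous_phaseFun F))
    | algebraMap c => simpa only [AlgHomClass.commutes] using continuous_const
    | add x y _ _ hx hy => simp only [_root_.map_add]; exact hx.add hy
    | mul x y _ _ hx hy => simp only [_root_.map_mul]; exact hx.mul hy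
    | star x _ hx => simp only [StarHomClass.map_star]; exact hx.star
  refine continuous_of_uniform_approx_of_continuous fun u hu => ?_
  obtain ⟨ε, hε, hεu⟩ := Metric.mem_uniformity_dist.1 hu
  obtain ⟨b, hb, hab⟩ := Metric.mem_closure_iff.1 ha ε hε
  refine ⟨fun t => RepProd.twist φ F t b, hS b hb, fun t => hεu ?_⟩
  refine lt_of_le_of_lt ?_ hab
  rw [dist_eq_norm, dist_eq_norm, ← map_sub]
  exact NonUnitalStarAlgHom.norm_apply_le _ _

/-- The flow `α^F` on `C(X) ⋊_φ ℤ`, determined by `α^F_t(f U) = f U e^{-itF}`. -/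
def potentialFlow {X : Type u} [TopologicalSpace X] [CompactSpace X] (φ : X ≃ₜ X)
    (F : C(X, ℝ)) : CStarFlow (CrossedProduct φ) where
  toFun t := ((RepProd.twist φ F t).comp (CrossedProduct.subalgebra φ).subtype).codRestrict
    (CrossedProduct.subalgebra φ) fun a => RepProd.twist_mem φ F t a a.2
  map_zero := by
    ext a r
    exact eq_of_heq (congr_arg_heq (fun r => a.1 r) (r.twist_zero F))
  map_add s t := by
    ext a r
    have h := congr_arg_heq (fun r => a.1 r) (r.twist_twist F s t)
    exact (eq_of_heq h).symm
  continuous a := (RepProd.continuous_twist φ F a a.2).subtype_mk _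

theorem potentialFlow_apply {X : Type u} [TopologicalSpace X] [CompactSpace X] (φ : X ≃ₜ X)
    (F : C(X, ℝ)) (t : ℝ) (f : C(X, ℂ)) :
    (potentialFlow φ F).toFun t (CrossedProduct.ι φ f * CrossedProduct.U φ) =
      CrossedProduct.ι φ f * CrossedProduct.U φ * CrossedProduct.ι φ (phaseFun F t) := by
  rw [mul_assoc]
  rfl

end

/-!
Let `s_p(n)` be the Birkhoff sums of `F` along the orbit of `x_p`. A conformal measure on this orbit
must have mass proportional to `e^{β s_p(n)}` at `φⁿ(x_p)`, so it exists exactly when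
`∑ₙ e^{β s_p(n)} < ∞`. The flow of a coboundary `g - g ∘ φ` is implemented by `g`, and the flow
depends continuously on the potential, so every uniform limit of coboundaries has an approximately
inner flow.

It remains to find a limit of coboundaries with prescribed summability. Take
`F = ∑ₖ (Gₖ - Gₖ ∘ φ)`, where `Gₖ` equals `aₖ` at time zero and decreases to zero along the orbit
so slowly that the series of coboundaries converges in norm. The sums `s_p(n)` then stay close to
`aₖ` on a block of `n` whose length is a double exponential of the previous one. If `aₖ` is
`1 / |β_p|` times the logarithm of the length of the block, the critical exponent is `β_p`, and a
correction to `aₖ` of lower order, but larger than the error, decides whether the series converges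
at `β_p`.
-/

/-! ### Conformal measures on an orbit -/

section PointOrbit

open Filter MeasureTheory Topology
open scoped NNReal

variable {X : Type u} [TopologicalSpace X] (φ : X ≃ₜ X)

theorem zpow_add_one_apply (x : X) (n : ℤ) : (φ ^ (n + 1)) x = φ ((φ ^ n) x) := by
  rw [add_comm, zpow_add, zpow_one, Homeomorph.mul_apply]

theorem injective_zpow_apply {x : X} (hx : x ∉ Function.periodicPts φ) :
    Function.Injective fun n : ℤ => (φ ^ n) x := by
  intro m n h
  wlog hmn : m ≤ n generalizing m n
  · exact (this h.symm (le_of_not_ge hmn)).symm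
  obtain ⟨k, rfl⟩ := Int.le.dest hmn
  have hk : (φ ^ k) x = x := by
    simpa [zpow_add, Homeomorph.mul_apply] using h.symm
  have hper : Function.IsPeriodicPt φ k x := by
    rw [Function.IsPeriodicPt, ← hom_coe_pow _ rfl (fun _ _ => rfl) φ k]
    exact hk
  obtain rfl : k = 0 := by
    by_contra hk0
    exact hx ⟨k, Nat.pos_of_ne_zero hk0, hper⟩
  simp

/-- `s` is a two-sided sequence of Birkhoff sums of `F` along the orbit of `x`, with an arbitrary
value at `0`. -/
def IsOrbitPrimitive (F : C(X, ℝ)) (x : X) (s : ℤ → ℝ) : Prop :=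
  ∀ n, s (n + 1) = s n + F ((φ ^ n) x)

/-- `e^{β s(n)}`, the mass of `φⁿ(x)` under a conformal measure, up to a constant factor. -/
noncomputable def orbitWeight (β : ℝ) (s : ℤ → ℝ) (n : ℤ) : ℝ≥0∞ :=
  ENNReal.ofReal (Real.exp (β * s n))

theorem orbitWeight_ne_zero (β : ℝ) (s : ℤ → ℝ) (n : ℤ) : orbitWeight β s n ≠ 0 := by
  simp [orbitWeight, Real.exp_pos]

theorem orbitWeight_ne_top (β : ℝ) (s : ℤ → ℝ) (n : ℤ) : orbitWeight β s n ≠ ∞ :=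
  ENNReal.ofReal_ne_top

theorem tsum_orbitWeight_ne_top_iff (β : ℝ) (s : ℤ → ℝ) :
    ∑' n, orbitWeight β s n ≠ ∞ ↔ Summable fun n => Real.exp (β * s n) := by
  refine ⟨fun h => ?_, fun h => h.tsum_ofReal_ne_top⟩
  simpa [orbitWeight, ENNReal.toReal_ofReal, (Real.exp_pos _).le] using ENNReal.summable_toReal h

variable {φ} in
theorem IsOrbitPrimitive.orbitWeight_add_one {F : C(X, ℝ)} {x : X} {s : ℤ → ℝ}
    (hs : IsOrbitPrimitive φ F x s) (β : ℝ) (n : ℤ) : orbitWeight β s (n + 1) =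
      ENNReal.ofReal (Real.exp (β * F ((φ ^ n) x))) * orbitWeight β s n := by
  rw [orbitWeight, orbitWeight, ← ENNReal.ofReal_mul (Real.exp_pos _).le, ← Real.exp_add, hs n]
  ring_nf

variable [MeasurableSpace X]

/-- The measure with mass `w n` at `φⁿ(x)`. -/
noncomputable def orbitMeasure (x : X) (w : ℤ → ℝ≥0∞) : Measure X :=
  Measure.sum fun n => w n • Measure.dirac ((φ ^ n) x)

theorem lintegral_orbitMeasure (x : X) (w : ℤ → ℝ≥0∞) {f : X → ℝ≥0∞} (hf : Measurable f) :
    ∫⁻ y, f y ∂orbitMeasure φ x w = ∑' n, w n * f ((φ ^ n) x) := by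
  simp [orbitMeasure, lintegral_sum_measure, lintegral_smul_measure, lintegral_dirac' _ hf]

theorem orbitMeasure_apply (x : X) (w : ℤ → ℝ≥0∞) {B : Set X} (hB : MeasurableSet B) :
    orbitMeasure φ x w B = ∑' n, w n * B.indicator 1 ((φ ^ n) x) := by
  rw [← lintegral_indicator_one hB, lintegral_orbitMeasure φ x w (measurable_one.indicator hB)]

variable {φ} {F : C(X, ℝ)} {x : X} {β : ℝ}

theorem isConcentratedOn_orbitMeasure [MeasurableSingletonClass X] (w : ℤ → ℝ≥0∞) :
    IsConcentratedOn (orbitMeasure φ x w) (homeoOrbit φ x) := by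
  have hmeas : MeasurableSet (homeoOrbit φ x) := (Set.countable_range _).measurableSet
  rw [IsConcentratedOn, orbitMeasure_apply φ x w hmeas.compl]
  simp [homeoOrbit]

theorem isConformalMeasure_orbitMeasure [BorelSpace X] {w : ℤ → ℝ≥0∞}
    (hw : ∀ n, w (n + 1) = ENNReal.ofReal (Real.exp (β * F ((φ ^ n) x))) * w n)
    (hsum : ∑' n, w n = 1) :
    IsConformalMeasure φ F β (orbitMeasure φ x w) := by
  refine ⟨⟨?_⟩, fun B hB => ?_⟩
  · simpa [orbitMeasure_apply φ x w MeasurableSet.univ] using hsum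
  have hφB : MeasurableSet (φ '' B) := φ.measurableEmbedding.measurableSet_image.2 hB
  have hF : Measurable fun y => ENNReal.ofReal (Real.exp (β * F y)) := by fun_prop
  rw [← lintegral_indicator hB, lintegral_orbitMeasure φ x w (hF.indicator hB),
    orbitMeasure_apply φ x w hφB, ← (Equiv.addRight (1 : ℤ)).tsum_eq]
  refine tsum_congr fun n => ?_
  rw [Equiv.coe_addRight, zpow_add_one_apply, hw]
  by_cases h : (φ ^ n) x ∈ B <;> simp [h, mul_comm]

theorem IsConformalMeasure.measure_singleton_apply [MeasurableSingletonClass X] {m : Measure X}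
    (hm : IsConformalMeasure φ F β m) (y : X) :
    m {φ y} = ENNReal.ofReal (Real.exp (β * F y)) * m {y} := by
  simpa [lintegral_singleton, mul_comm] using hm.2 {y} (measurableSet_singleton y)

theorem IsConcentratedOn.tsum_measure_singleton [MeasurableSingletonClass X] {m : Measure X}
    [IsProbabilityMeasure m] (hm : IsConcentratedOn m (homeoOrbit φ x))
    (hx : x ∉ Function.periodicPts φ) : ∑' n : ℤ, m {(φ ^ n) x} = 1 := by
  have hmeas : MeasurableSet (homeoOrbit φ x) := (Set.countable_range _).measurableSet
  have hdisj : Pairwise (Function.onFun Disjoint fun n : ℤ => ({(φ ^ n) x} : Set X)) :=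
    fun i j hij => by simpa using (injective_zpow_apply φ hx).ne hij
  rw [← measure_iUnion hdisj fun _ => measurableSet_singleton _, Set.iUnion_singleton_eq_range]
  exact (prob_compl_eq_zero_iff hmeas).1 hm

theorem IsConformalMeasure.exists_measure_singleton_eq [MeasurableSingletonClass X] {m : Measure X}
    (hm : IsConformalMeasure φ F β m) {s : ℤ → ℝ} (hs : IsOrbitPrimitive φ F x s) :
    ∃ c : ℝ≥0∞, ∀ n : ℤ, m {(φ ^ n) x} = c * orbitWeight β s n := by
  have hper : Function.Periodic (fun n : ℤ => m {(φ ^ n) x} / orbitWeight β s n) 1 := by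
    intro n
    simp only [zpow_add_one_apply, hm.measure_singleton_apply, hs.orbitWeight_add_one]
    exact ENNReal.mul_div_mul_left _ _ (by simp [Real.exp_pos]) ENNReal.ofReal_ne_top
  refine ⟨m {(φ ^ (0 : ℤ)) x} / orbitWeight β s 0, fun n => ?_⟩
  rw [← hper.zsmul_eq n, smul_eq_mul, mul_one,
    ENNReal.div_mul_cancel (orbitWeight_ne_zero β s n) (orbitWeight_ne_top β s n)]

theorem exists_isConformalMeasure_iff_summable [T1Space X] [BorelSpace X]
    (hx : x ∉ Function.periodicPts φ) {s : ℤ → ℝ} (hs : IsOrbitPrimitive φ F x s) (β : ℝ) :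
    (∃ m : Measure X, IsConformalMeasure φ F β m ∧ IsConcentratedOn m (homeoOrbit φ x)) ↔
      Summable fun n => Real.exp (β * s n) := by
  rw [← tsum_orbitWeight_ne_top_iff]
  constructor
  · rintro ⟨m, hm, hconc⟩ htop
    have := hm.1
    obtain ⟨c, hc⟩ := hm.exists_measure_singleton_eq hs
    have hsum := hconc.tsum_measure_singleton hx
    simp_rw [hc, ENNReal.tsum_mul_left, htop, ENNReal.mul_top'] at hsum
    split_ifs at hsum <;> simp at hsum
  · intro hZ
    have hZ0 : ∑' n, orbitWeight β s n ≠ 0 := fun h =>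
      orbitWeight_ne_zero β s 0 (ENNReal.tsum_eq_zero.1 h 0)
    refine ⟨orbitMeasure φ x fun n => (∑' k, orbitWeight β s k)⁻¹ * orbitWeight β s n,
      isConformalMeasure_orbitMeasure (fun n => ?_) ?_, isConcentratedOn_orbitMeasure _⟩
    · rw [hs.orbitWeight_add_one, mul_left_comm]
    · rw [ENNReal.tsum_mul_left, ENNReal.inv_mul_cancel hZ0 hZ]

end PointOrbit

/-! ### Flows of limits of coboundaries -/

section Generators

variable {A B : Type*} [CStarAlgebra A] [CStarAlgebra B] {s : Set A}

theorem starAlgHom_ext_of_topologicalClosure_adjoin_eq_top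
    (hs : (StarAlgebra.adjoin ℂ s).topologicalClosure = ⊤) {f g : A →⋆ₐ[ℂ] B} (h : s.EqOn f g) :
    f = g := by
  have hle : (StarAlgebra.adjoin ℂ s).topologicalClosure ≤ StarAlgHom.equalizer f g :=
    StarSubalgebra.topologicalClosure_minimal (StarAlgHom.adjoin_le_equalizer f g h)
      (isClosed_eq (map_continuous f) (map_continuous g))
  exact StarAlgHom.ext fun a => hle (hs ▸ StarSubalgebra.mem_top)

theorem continuous_starAlgHom_apply_of_adjoin {P : Type*} [TopologicalSpace P]
    {Φ : P → A →⋆ₐ[ℂ] B} (h : ∀ a ∈ s, Continuous fun p => Φ p a) {a : A}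
    (ha : a ∈ StarAlgebra.adjoin ℂ s) : Continuous fun p => Φ p a := by
  induction ha using StarAlgebra.adjoin_induction with
  | mem a ha => exact h a ha
  | algebraMap c => simpa only [AlgHomClass.commutes] using continuous_const
  | add a b _ _ iha ihb => simpa only [map_add] using iha.fun_add ihb
  | mul a b _ _ iha ihb => simpa only [map_mul] using iha.fun_mul ihb
  | star a _ iha => simpa only [map_star] using iha.star

theorem continuous_starAlgHom_apply {P : Type*} [TopologicalSpace P]
    (hs : (StarAlgebra.adjoin ℂ s).topologicalClosure = ⊤) {Φ : P → A →⋆ₐ[ℂ] B}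
    (h : ∀ a ∈ s, Continuous fun p => Φ p a) (a : A) : Continuous fun p => Φ p a := by
  refine continuous_of_uniform_approx_of_continuous fun u hu => ?_
  obtain ⟨ε, hε, hεu⟩ := Metric.mem_uniformity_dist.1 hu
  have ha : a ∈ closure (StarAlgebra.adjoin ℂ s : Set A) := by
    rw [← StarSubalgebra.topologicalClosure_coe, hs]
    exact Set.mem_univ a
  obtain ⟨b, hb, hab⟩ := Metric.mem_closure_iff.1 ha ε hε
  refine ⟨fun p => Φ p b, continuous_starAlgHom_apply_of_adjoin h hb, fun p => hεu ?_⟩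
  rw [dist_eq_norm, ← map_sub]
  exact (NonUnitalStarAlgHom.norm_apply_le (Φ p) _).trans_lt (by rwa [← dist_eq_norm])

end Generators

section Flow

open Filter Topology

variable {X : Type u} [TopologicalSpace X]

/-- The additive coboundary of `g`. With this sign, its flow is implemented by `g` itself. -/
noncomputable def coboundary (φ : X ≃ₜ X) (g : C(X, ℝ)) : C(X, ℝ) := g - g.comp (φ : C(X, X))

theorem phaseFun_coboundary (φ : X ≃ₜ X) (g : C(X, ℝ)) (t : ℝ) :
    phaseFun (coboundary φ g) t = (phaseFun g (-t)).comp (φ : C(X, X)) * phaseFun g t := by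
  ext y
  simp only [phaseFun, coboundary, ContinuousMap.coe_mk, ContinuousMap.sub_apply,
    ContinuousMap.comp_apply, ContinuousMap.mul_apply, ← Complex.exp_add]
  push_cast
  ring_nf

variable [CompactSpace X]

theorem continuous_phaseFun_uncurry :
    Continuous fun p : C(X, ℝ) × ℝ => phaseFun p.1 p.2 := by
  apply ContinuousMap.continuous_of_continuous_uncurry
  simp only [Function.uncurry_def, phaseFun, ContinuousMap.coe_mk]
  fun_prop

theorem exp_smul_ofReal_comp (g : C(X, ℝ)) (t : ℝ) :
    NormedSpace.exp ((Complex.I * t) • (⟨fun y => (g y : ℂ), by fun_prop⟩ : C(X, ℂ))) =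
      phaseFun g (-t) := by
  ext y
  let : NormedAlgebra ℚ C(X, ℂ) := NormedAlgebra.restrictScalars ℚ ℂ _
  have h := NormedSpace.map_exp (ContinuousMap.evalStarAlgHom ℂ ℂ y) (map_continuous _)
    ((Complex.I * t) • (⟨fun y => (g y : ℂ), by fun_prop⟩ : C(X, ℂ)))
  simp only [ContinuousMap.evalStarAlgHom_apply] at h
  rw [h, ← Complex.exp_eq_exp_ℂ]
  simp [phaseFun]

namespace CrossedProduct

variable (φ : X ≃ₜ X)

theorem topologicalClosure_adjoin_eq_top :
    (StarAlgebra.adjoin ℂ (Set.range (ι φ) ∪ {U φ})).topologicalClosure = ⊤ := by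
  have himage : Subtype.val '' (Set.range (ι φ) ∪ {U φ}) =
      Set.range (RepProd.ofFun φ) ∪ {RepProd.ofUnitary φ} := by
    rw [Set.image_union, Set.image_singleton, ← Set.range_comp]
    rfl
  have hadjoin : Subtype.val '' (StarAlgebra.adjoin ℂ (Set.range (ι φ) ∪ {U φ}) :
      Set (CrossedProduct φ)) =
      (StarAlgebra.adjoin ℂ (Set.range (RepProd.ofFun φ) ∪ {RepProd.ofUnitary φ}) :
        Set (RepProd φ)) := by
    rw [← himage]
    exact congrArg SetLike.coe (StarAlgHom.map_adjoin (subalgebra φ).subtype _)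
  refine StarSubalgebra.eq_top_iff.2 fun a => ?_
  change a ∈ closure _
  rw [closure_subtype, hadjoin]
  exact a.2

theorem ι_mul_U_mul_ι (f g : C(X, ℂ)) :
    ι φ f * U φ * ι φ g = U φ * ι φ (f.comp (φ : C(X, X)) * g) := by
  have hf : U φ * ι φ (f.comp (φ : C(X, X))) * star (U φ) = ι φ f := by
    rw [covariance]
    congr 1
    ext y
    simp
  rw [← hf, map_mul, mul_assoc _ (star _), (Unitary.mem_iff.1 (U_mem_unitary φ)).1, mul_one,
    mul_assoc]

end CrossedProduct

open CrossedProduct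

variable (φ : X ≃ₜ X)

theorem potentialFlow_ι (F : C(X, ℝ)) (t : ℝ) (f : C(X, ℂ)) :
    (potentialFlow φ F).toFun t (ι φ f) = ι φ f := rfl

theorem potentialFlow_U (F : C(X, ℝ)) (t : ℝ) :
    (potentialFlow φ F).toFun t (U φ) = U φ * ι φ (phaseFun F t) := rfl

theorem continuous_potentialFlow_uncurry (a : CrossedProduct φ) :
    Continuous fun p : C(X, ℝ) × ℝ => (potentialFlow φ p.1).toFun p.2 a := by
  refine continuous_starAlgHom_apply (Φ := fun p : C(X, ℝ) × ℝ => (potentialFlow φ p.1).toFun p.2)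
    (topologicalClosure_adjoin_eq_top φ) ?_ a
  rintro _ (⟨f, rfl⟩ | rfl)
  · simpa only [potentialFlow_ι] using continuous_const
  · simp only [potentialFlow_U]
    exact continuous_const.mul ((map_continuous (ι φ)).comp continuous_phaseFun_uncurry)

theorem potentialFlow_coboundary_eq_conj (g : C(X, ℝ)) (t : ℝ) (a : CrossedProduct φ) :
    (potentialFlow φ (coboundary φ g)).toFun t a =
      ι φ (phaseFun g (-t)) * a * ι φ (phaseFun g t) := by
  let u : unitary (CrossedProduct φ) :=
    ⟨ι φ (phaseFun g (-t)), Unitary.map_mem (ι φ) (phaseFun_mem_unitary g (-t))⟩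
  have hconj (b : CrossedProduct φ) : (Unitary.conjStarAlgAut ℂ _ u : _ →⋆ₐ[ℂ] _) b =
      ι φ (phaseFun g (-t)) * b * ι φ (phaseFun g t) := by
    change ι φ (phaseFun g (-t)) * b * star (ι φ (phaseFun g (-t))) = _
    rw [← map_star, star_phaseFun, neg_neg]
  rw [← hconj]
  refine DFunLike.congr_fun (starAlgHom_ext_of_topologicalClosure_adjoin_eq_top
    (topologicalClosure_adjoin_eq_top φ) ?_) a
  rintro _ (⟨f, rfl⟩ | rfl)
  · rw [hconj, potentialFlow_ι, ← map_mul, ← map_mul, mul_right_comm, ← phaseFun_add,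
      neg_add_cancel, phaseFun_zero, one_mul]
  · rw [hconj, potentialFlow_U, ι_mul_U_mul_ι, phaseFun_coboundary]

theorem potentialFlow_coboundary_isInner (g : C(X, ℝ)) :
    (potentialFlow φ (coboundary φ g)).IsInner := by
  let G : C(X, ℂ) := ⟨fun y => (g y : ℂ), by fun_prop⟩
  have hG : IsSelfAdjoint G := by ext y; simp [G]
  have hexp (t : ℝ) : NormedSpace.exp ((Complex.I * t) • ι φ G) = ι φ (phaseFun g (-t)) := by
    let : NormedAlgebra ℚ C(X, ℂ) := NormedAlgebra.restrictScalars ℚ ℂ _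
    let : NormedAlgebra ℚ (CrossedProduct φ) := NormedAlgebra.restrictScalars ℚ ℂ _
    rw [← exp_smul_ofReal_comp, NormedSpace.map_exp (ι φ) (map_continuous _), map_smul]
  refine ⟨ι φ G, hG.map _, fun t a => ?_⟩
  have hneg : -((Complex.I * t) • ι φ G) = (Complex.I * (-t : ℝ)) • ι φ G := by simp
  rw [hneg, hexp, hexp, neg_neg, potentialFlow_coboundary_eq_conj]

theorem potentialFlow_isApproximatelyInner_of_mem_closure {F : C(X, ℝ)}
    (hF : F ∈ closure (Set.range (coboundary φ))) : (potentialFlow φ F).IsApproximatelyInner := by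
  obtain ⟨f, hf, hlim⟩ := mem_closure_iff_seq_limit.1 hF
  choose g hg using hf
  refine ⟨fun n => potentialFlow φ (f n), fun n => ?_, fun a K hK => ?_⟩
  · simpa only [hg n] using potentialFlow_coboundary_isInner φ (g n)
  · let H : C(C(X, ℝ) × ℝ, CrossedProduct φ) := ⟨_, continuous_potentialFlow_uncurry φ a⟩
    have hH := (H.curry.continuous.tendsto F).comp hlim
    exact ContinuousMap.tendsto_iff_forall_isCompact_tendstoUniformlyOn.1 hH K hK

end Flow

/-! ### Slowly varying plateaus -/

section Trapezoid

open scoped NNReal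

/-- The trapezoidal profile on `ℤ`: equal to `1` for `|j| ≤ N` and to `0` for `|j| ≥ 2N`, with
slope `±1/N` in between. The subtraction in `ℝ≥0` is truncated. -/
noncomputable def trapezoid (N : ℕ) (j : ℤ) : ℝ≥0 := min 1 (2 - j.natAbs / N)

variable {N : ℕ} {i j : ℤ}

theorem trapezoid_le_one : trapezoid N j ≤ 1 := min_le_left _ _

theorem trapezoid_eq_one (hj : j.natAbs ≤ N) : trapezoid N j = 1 := by
  have h : (j.natAbs : ℝ≥0) / N ≤ 1 := div_le_one_of_le₀ (by exact_mod_cast hj) zero_le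
  refine min_eq_left (le_tsub_of_add_le_right ?_)
  calc 1 + (j.natAbs : ℝ≥0) / N ≤ 1 + 1 := by gcongr
    _ = 2 := one_add_one_eq_two

theorem trapezoid_eq_zero (hN : 0 < N) (hj : 2 * N ≤ j.natAbs) : trapezoid N j = 0 := by
  have h : 2 ≤ (j.natAbs : ℝ≥0) / N := by
    rw [le_div_iff₀ (by exact_mod_cast hN)]
    exact_mod_cast hj
  rw [trapezoid, tsub_eq_zero_of_le h, min_eq_right zero_le_one]

theorem trapezoid_le_add (hij : (i - j).natAbs ≤ 1) :
    trapezoid N i ≤ trapezoid N j + (N : ℝ≥0)⁻¹ := by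
  have h : (j.natAbs : ℝ≥0) / N ≤ i.natAbs / N + (N : ℝ≥0)⁻¹ := by
    rw [← one_div, ← add_div]
    gcongr
    exact_mod_cast (by omega : j.natAbs ≤ i.natAbs + 1)
  rw [trapezoid, trapezoid, ← min_add_add_right]
  refine min_le_min le_self_add (tsub_le_iff_right.2 ?_)
  calc (2 : ℝ≥0) ≤ 2 - j.natAbs / N + j.natAbs / N := le_tsub_add
    _ ≤ 2 - j.natAbs / N + (N : ℝ≥0)⁻¹ + i.natAbs / N := by
      rw [add_assoc, add_comm (N : ℝ≥0)⁻¹]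
      gcongr

end Trapezoid

section Plateau

open scoped NNReal

theorem exists_continuous_one_of_notMem_isClosed {X : Type*} [TopologicalSpace X] [T4Space X]
    {y : X} {S : Set X} (hS : IsClosed S) (hy : y ∉ S) :
    ∃ h : C(X, ℝ≥0), h y = 1 ∧ (∀ z ∈ S, h z = 0) ∧ ∀ z, h z ≤ 1 := by
  obtain ⟨h, h0, h1, h01⟩ :=
    exists_continuous_zero_one_of_isClosed hS isClosed_singleton (Set.disjoint_singleton_right.2 hy)
  refine ⟨⟨fun z => (h z).toNNReal, by fun_prop⟩, ?_, fun z hz => ?_, fun z => ?_⟩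
  · simp [h1 rfl]
  · simp [h0 hz]
  · simpa using (h01 z).2

variable {X : Type u} [TopologicalSpace X] {φ : X ≃ₜ X} {κ : Type*}

theorem injective_zpow_apply_prod {x : κ → X} (hx : ∀ p, x p ∉ Function.periodicPts φ)
    (hdisj : Pairwise (Function.onFun Disjoint fun p => homeoOrbit φ (x p))) :
    Function.Injective fun i : κ × ℤ => (φ ^ i.2) (x i.1) := by
  rintro ⟨p, m⟩ ⟨p', n⟩ h
  obtain rfl : p = p' := by
    by_contra hne
    exact Set.disjoint_left.1 (hdisj hne) ⟨m, rfl⟩ ⟨n, h.symm⟩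
  exact congrArg _ (injective_zpow_apply φ (hx p) h)

section Envelope

/-- The upper envelope of trapezoidal profiles of height `a p`, carried along the orbit pieces
`φʲ(supp (h p))`, `|j| ≤ 2N`. -/
noncomputable def plateauFun [Fintype κ] (φ : X ≃ₜ X) (a : κ → ℝ≥0) (h : κ → C(X, ℝ≥0))
    (N : ℕ) (y : X) : ℝ≥0 :=
  (Finset.univ ×ˢ Finset.Icc (-(2 * N : ℤ)) (2 * N)).sup fun i : κ × ℤ =>
    a i.1 * trapezoid N i.2 * h i.1 ((φ ^ (-i.2)) y)

variable [Fintype κ] {a : κ → ℝ≥0} {h : κ → C(X, ℝ≥0)} {c : ℝ≥0} {N : ℕ}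

theorem continuous_plateauFun : Continuous (plateauFun φ a h N) := by
  refine Continuous.finset_sup_apply fun i _ => ?_
  have hφ : Continuous fun y => (φ ^ (-i.2)) y := (φ ^ (-i.2)).continuous
  fun_prop

theorem mul_trapezoid_mul_le_plateauFun (hN : 0 < N) (p : κ) (j : ℤ) (y : X) :
    a p * trapezoid N j * h p ((φ ^ (-j)) y) ≤ plateauFun φ a h N y := by
  by_cases hj : j ∈ Finset.Icc (-(2 * N : ℤ)) (2 * N)
  · exact Finset.le_sup (f := fun i : κ × ℤ => a i.1 * trapezoid N i.2 * h i.1 ((φ ^ (-i.2)) y))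
      (Finset.mk_mem_product (Finset.mem_univ p) hj)
  · rw [Finset.mem_Icc] at hj
    simp [trapezoid_eq_zero (j := j) hN (by omega)]

theorem plateauFun_le (hac : ∀ p, a p ≤ c) (hh : ∀ p y, h p y ≤ 1) (y : X) :
    plateauFun φ a h N y ≤ c := by
  refine Finset.sup_le fun i _ => ?_
  calc a i.1 * trapezoid N i.2 * h i.1 ((φ ^ (-i.2)) y) ≤ c * 1 * 1 := by
        gcongr
        exacts [hac _, trapezoid_le_one, hh _ _]
    _ = c := by rw [mul_one, mul_one]

theorem plateauFun_le_add (hN : 0 < N) (hac : ∀ p, a p ≤ c) (hh : ∀ p y, h p y ≤ 1) {e : ℤ}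
    (he : e.natAbs ≤ 1) (y : X) :
    plateauFun φ a h N y ≤ plateauFun φ a h N ((φ ^ e) y) + c * (N : ℝ≥0)⁻¹ := by
  refine Finset.sup_le fun ⟨p, j⟩ _ => ?_
  have hshift : (φ ^ (-(j + e))) ((φ ^ e) y) = (φ ^ (-j)) y := by
    rw [← Homeomorph.mul_apply, ← zpow_add, neg_add, neg_add_cancel_right]
  calc a p * trapezoid N j * h p ((φ ^ (-j)) y)
      ≤ a p * (trapezoid N (j + e) + (N : ℝ≥0)⁻¹) * h p ((φ ^ (-j)) y) := by
        gcongr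
        exact trapezoid_le_add (by omega)
    _ = a p * trapezoid N (j + e) * h p ((φ ^ (-(j + e))) ((φ ^ e) y)) +
          a p * (N : ℝ≥0)⁻¹ * h p ((φ ^ (-j)) y) := by rw [hshift]; ring
    _ ≤ plateauFun φ a h N ((φ ^ e) y) + c * (N : ℝ≥0)⁻¹ * 1 := by
        gcongr
        exacts [mul_trapezoid_mul_le_plateauFun hN p _ _, hac p, hh _ _]
    _ = plateauFun φ a h N ((φ ^ e) y) + c * (N : ℝ≥0)⁻¹ := by rw [mul_one]

theorem plateauFun_zpow_apply {x : κ → X} {M : ℕ} (hN : 0 < N) (hh : ∀ p y, h p y ≤ 1)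
    (hone : ∀ p, h p (x p) = 1)
    (hzero : ∀ p, ∀ i : κ × ℤ, i ≠ (p, 0) → i.2.natAbs ≤ M + 2 * N → h p ((φ ^ i.2) (x i.1)) = 0)
    (p : κ) {n : ℤ} (hn : n.natAbs ≤ M) :
    plateauFun φ a h N ((φ ^ n) (x p)) = a p * trapezoid N n := by
  have hcomp (j : ℤ) : (φ ^ (-j)) ((φ ^ n) (x p)) = (φ ^ (n - j)) (x p) := by
    rw [← Homeomorph.mul_apply, ← zpow_add, neg_add_eq_sub]
  apply le_antisymm
  · refine Finset.sup_le fun ⟨p', j⟩ hj => ?_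
    rw [Finset.mem_product, Finset.mem_Icc] at hj
    simp only [hcomp]
    by_cases hpj : ((p, n - j) : κ × ℤ) = (p', 0)
    · obtain ⟨rfl, hnj⟩ := Prod.mk.inj hpj
      obtain rfl : n = j := sub_eq_zero.1 hnj
      exact mul_le_of_le_one_right' (hh _ _)
    · rw [hzero p' (p, n - j) hpj (by dsimp only at hj ⊢; omega), mul_zero]
      exact zero_le
  · have hle := mul_trapezoid_mul_le_plateauFun (φ := φ) (a := a) (h := h) hN p n ((φ ^ n) (x p))
    rwa [hcomp, sub_self, zpow_zero, Homeomorph.one_apply, hone, mul_one] at hle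

end Envelope

/-- `G` varies by at most `c/N` under one step of `φ`, while along the orbit of each `x p` it
follows, up to time `M`, a trapezoidal profile of height `a p` and length `N`. -/
structure IsSlowPlateau (φ : X ≃ₜ X) (x : κ → X) (a : κ → ℝ) (c : ℝ) (N M : ℕ)
    (G : C(X, ℝ)) : Prop where
  nonneg : ∀ y, 0 ≤ G y
  le : ∀ y, G y ≤ c
  abs_sub_le : ∀ y, |G y - G (φ y)| ≤ c / N
  zpow_apply : ∀ p (n : ℤ), n.natAbs ≤ M → G ((φ ^ n) (x p)) = a p * trapezoid N n

theorem exists_isolating_functions [T4Space X] [Finite κ] {x : κ → X}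
    (hx : ∀ p, x p ∉ Function.periodicPts φ)
    (hdisj : Pairwise (Function.onFun Disjoint fun p => homeoOrbit φ (x p))) (L : ℕ) :
    ∃ h : κ → C(X, ℝ≥0), (∀ p, h p (x p) = 1) ∧ (∀ p y, h p y ≤ 1) ∧
      ∀ p, ∀ i : κ × ℤ, i ≠ (p, 0) → i.2.natAbs ≤ L → h p ((φ ^ i.2) (x i.1)) = 0 := by
  let I (p : κ) : Set (κ × ℤ) := {i | i ≠ (p, 0) ∧ i.2.natAbs ≤ L}
  have hfin (p : κ) : (I p).Finite := by
    refine (Set.finite_univ.prod (Set.finite_Icc (-(L : ℤ)) L)).subset fun i hi => ?_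
    exact ⟨Set.mem_univ _, by have := hi.2; rw [Set.mem_Icc]; omega⟩
  have hnotMem (p : κ) : x p ∉ (fun i : κ × ℤ => (φ ^ i.2) (x i.1)) '' I p := by
    rintro ⟨i, hi, hip⟩
    exact hi.1 (injective_zpow_apply_prod hx hdisj (by simpa using hip))
  choose h hone hzero hle using fun p =>
    exists_continuous_one_of_notMem_isClosed ((hfin p).image _).isClosed (hnotMem p)
  exact ⟨h, hone, hle, fun p i hi hiL => hzero p _ ⟨i, ⟨hi, hiL⟩, rfl⟩⟩

theorem exists_isSlowPlateau [T4Space X] [Finite κ] {x : κ → X}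
    (hx : ∀ p, x p ∉ Function.periodicPts φ)
    (hdisj : Pairwise (Function.onFun Disjoint fun p => homeoOrbit φ (x p)))
    {a : κ → ℝ} {c : ℝ} {N : ℕ} (ha : ∀ p, 0 ≤ a p) (hc : 0 ≤ c) (hac : ∀ p, a p ≤ c) (hN : 0 < N)
    (M : ℕ) : ∃ G, IsSlowPlateau φ x a c N M G := by
  have := Fintype.ofFinite κ
  lift a to κ → ℝ≥0 using ha
  lift c to ℝ≥0 using hc
  replace hac (p : κ) : a p ≤ c := NNReal.coe_le_coe.1 (hac p)
  obtain ⟨h, hone, hle, hzero⟩ := exists_isolating_functions hx hdisj (M + 2 * N)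
  let G := plateauFun φ a h N
  refine ⟨⟨fun y => (G y : ℝ), NNReal.continuous_coe.comp continuous_plateauFun⟩,
    fun y => NNReal.coe_nonneg _, fun y => ?_, fun y => ?_, fun p n hn => ?_⟩
  · exact_mod_cast plateauFun_le hac hle y
  · have hfwd : G y ≤ G (φ y) + c * (N : ℝ≥0)⁻¹ :=
      plateauFun_le_add hN hac hle (e := 1) le_rfl y
    have hbwd : G (φ y) ≤ G y + c * (N : ℝ≥0)⁻¹ := by
      have := plateauFun_le_add (φ := φ) hN hac hle (e := -1) le_rfl (φ y)
      rwa [zpow_neg_one, show (φ⁻¹ : X ≃ₜ X) (φ y) = y from φ.symm_apply_apply y] at this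
    rw [← NNReal.coe_le_coe] at hfwd hbwd
    push_cast at hfwd hbwd
    rw [div_eq_mul_inv, abs_sub_le_iff]
    exact ⟨sub_le_iff_le_add'.2 hfwd, sub_le_iff_le_add'.2 hbwd⟩
  · exact congrArg NNReal.toReal (plateauFun_zpow_apply hN hle hone hzero p hn)

end Plateau

/-! ### Potentials with prescribed plateaus -/

section Potential

/-- `d` vanishes on `|n| ≤ N`, has a plateau of height `a` on `2N ≤ |n| ≤ M`, and is
unconstrained beyond `M`, apart from the bound `|d| ≤ c`. -/
structure IsPlateauStep (N M : ℕ) (a c : ℝ) (d : ℤ → ℝ) : Prop where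
  eq_zero : ∀ n : ℤ, n.natAbs ≤ N → d n = 0
  nonneg : ∀ n : ℤ, n.natAbs ≤ M → 0 ≤ d n
  eq : ∀ n : ℤ, 2 * N ≤ n.natAbs → n.natAbs ≤ M → d n = a
  abs_le : ∀ n, |d n| ≤ c

/-- In the `k`-th block `2 N k ≤ |n| ≤ 2 N (k + 1)`, the sequence `s` is `a k` up to an error
`B k`; the upper bound is only required in the half of the block where `|n| ≤ N (k + 1)`. -/
structure HasPlateaus (N : ℕ → ℕ) (a B : ℕ → ℝ) (s : ℤ → ℝ) : Prop where
  sub_le : ∀ k (n : ℤ), 2 * N k ≤ n.natAbs → n.natAbs ≤ 2 * N (k + 1) → a k - B k ≤ s n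
  le_add : ∀ k (n : ℤ), 2 * N k ≤ n.natAbs → n.natAbs ≤ N (k + 1) → s n ≤ a k + B k

section Series

variable {N : ℕ → ℕ} {a c : ℕ → ℝ} {d : ℕ → ℤ → ℝ}

theorem summable_of_isPlateauStep (hN : StrictMono N)
    (hd : ∀ k, IsPlateauStep (N k) (2 * N (k + 1)) (a k) (c k) (d k)) (n : ℤ) :
    Summable fun k => d k n := by
  refine summable_of_ne_finset_zero (s := Finset.range n.natAbs) fun k hk => (hd k).eq_zero n ?_
  exact (not_lt.1 (mt Finset.mem_range.2 hk)).trans (hN.id_le k)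

theorem hasPlateaus_tsum (hN : StrictMono N)
    (hd : ∀ k, IsPlateauStep (N k) (2 * N (k + 1)) (a k) (c k) (d k)) :
    HasPlateaus N a (fun k => ∑ i ∈ Finset.range k, c i) fun n => ∑' k, d k n := by
  have hpast (k : ℕ) (n : ℤ) : |∑ i ∈ Finset.range k, d i n| ≤ ∑ i ∈ Finset.range k, c i :=
    (Finset.abs_sum_le_sum_abs _ _).trans (Finset.sum_le_sum fun i _ => (hd i).abs_le n)
  constructor
  · intro k n hn hn'
    have hpartial : ∑ i ∈ Finset.range (k + 1), d i n ≤ ∑' i, d i n := by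
      refine (summable_of_isPlateauStep hN hd n).sum_le_tsum _ fun i hi => (hd i).nonneg n ?_
      have hki : k + 1 ≤ i + 1 := (not_lt.1 (mt Finset.mem_range.2 hi)).trans i.le_succ
      exact hn'.trans (Nat.mul_le_mul_left 2 (hN.monotone hki))
    rw [Finset.sum_range_succ, (hd k).eq n hn hn'] at hpartial
    linarith [(abs_le.1 (hpast k n)).1]
  · intro k n hn hn'
    have hfinite : ∑' i, d i n = ∑ i ∈ Finset.range (k + 1), d i n :=
      tsum_eq_sum fun i hi => (hd i).eq_zero n
        (hn'.trans (hN.monotone (not_lt.1 (mt Finset.mem_range.2 hi))))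
    rw [hfinite, Finset.sum_range_succ, (hd k).eq n hn (hn'.trans (by omega))]
    linarith [(abs_le.1 (hpast k n)).2]

end Series

variable {X : Type u} [TopologicalSpace X] {φ : X ≃ₜ X} {κ : Type*} {x : κ → X}

theorem IsSlowPlateau.isPlateauStep {a : κ → ℝ} {c : ℝ} {N M : ℕ} {G : C(X, ℝ)}
    (hG : IsSlowPlateau φ x a c N M G) (ha : ∀ p, 0 ≤ a p) (hN : 0 < N) (hNM : N ≤ M) (p : κ) :
    IsPlateauStep N M (a p) c fun n => G (x p) - G ((φ ^ n) (x p)) := by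
  have hG0 : G (x p) = a p := by
    simpa [trapezoid_eq_one] using hG.zpow_apply p 0 (Nat.zero_le _)
  have hsub (n : ℤ) (hn : n.natAbs ≤ M) :
      G (x p) - G ((φ ^ n) (x p)) = a p * (1 - trapezoid N n) := by
    rw [hG0, hG.zpow_apply p n hn, mul_one_sub]
  refine ⟨fun n hn => ?_, fun n hn => ?_, fun n hn hn' => ?_, fun n => ?_⟩
  · rw [hsub n (hn.trans hNM), trapezoid_eq_one hn, NNReal.coe_one, sub_self, mul_zero]
  · rw [hsub n hn]
    exact mul_nonneg (ha p) (sub_nonneg.2 (NNReal.coe_le_one.2 trapezoid_le_one))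
  · rw [hsub n hn', trapezoid_eq_zero hN hn, NNReal.coe_zero, sub_zero, mul_one]
  · exact abs_sub_le_of_nonneg_of_le (hG.nonneg _) (hG.le _) (hG.nonneg _) (hG.le _)

theorem tsum_coboundary_mem_closure {G : ℕ → C(X, ℝ)}
    (hG : Summable fun k => coboundary φ (G k)) :
    ∑' k, coboundary φ (G k) ∈ closure (Set.range (coboundary φ)) := by
  refine mem_closure_of_tendsto hG.hasSum.tendsto_sum_nat (.of_forall fun n => ?_)
  refine ⟨∑ k ∈ Finset.range n, G k, ?_⟩
  ext y
  simp [coboundary, ContinuousMap.sum_apply]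

theorem isOrbitPrimitive_tsum {G : ℕ → C(X, ℝ)} (hG : Summable fun k => coboundary φ (G k))
    {y : X} (hs : ∀ n : ℤ, Summable fun k => G k y - G k ((φ ^ n) y)) :
    IsOrbitPrimitive φ (∑' k, coboundary φ (G k)) y fun n => ∑' k, (G k y - G k ((φ ^ n) y)) := by
  intro n
  have hF : HasSum (fun k => G k ((φ ^ n) y) - G k (φ ((φ ^ n) y)))
      ((∑' k, coboundary φ (G k)) ((φ ^ n) y)) :=
    hG.hasSum.map (ContinuousMap.evalAlgHom ℝ ℝ ((φ ^ n) y)) (continuous_eval_const _)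
  rw [← ((hs n).hasSum.add hF).tsum_eq]
  simp only [zpow_add_one_apply, sub_add_sub_cancel]

theorem exists_potential_of_scales [CompactSpace X] [T2Space X] [Finite κ]
    (hx : ∀ p, x p ∉ Function.periodicPts φ)
    (hdisj : Pairwise (Function.onFun Disjoint fun p => homeoOrbit φ (x p)))
    {N : ℕ → ℕ} (hN : StrictMono N) (hN0 : 0 < N 0) {c : ℕ → ℝ} (hc : ∀ k, 0 ≤ c k)
    (hcN : Summable fun k => c k / N k) {a : κ → ℕ → ℝ} (ha : ∀ p k, 0 ≤ a p k)
    (hac : ∀ p k, a p k ≤ c k) :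
    ∃ F ∈ closure (Set.range (coboundary φ)), ∀ p, ∃ s, IsOrbitPrimitive φ F (x p) s ∧
      HasPlateaus N (a p) (fun k => ∑ i ∈ Finset.range k, c i) s := by
  have hNpos (k : ℕ) : 0 < N k := hN0.trans_le (hN.monotone k.zero_le)
  choose G hG using fun k => exists_isSlowPlateau hx hdisj (ha · k) (hc k) (hac · k) (hNpos k)
    (2 * N (k + 1))
  have hcoboundary : Summable fun k => coboundary φ (G k) :=
    .of_norm_bounded hcN fun k =>
      (ContinuousMap.norm_le _ (div_nonneg (hc k) (N k).cast_nonneg)).2 (hG k).abs_sub_le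
  have hstep (p : κ) (k : ℕ) := (hG k).isPlateauStep (ha · k) (hNpos k)
    ((hN k.lt_succ_self).le.trans (Nat.le_mul_of_pos_left _ two_pos)) p
  exact ⟨_, tsum_coboundary_mem_closure hcoboundary, fun p =>
    ⟨_, isOrbitPrimitive_tsum hcoboundary (summable_of_isPlateauStep hN (hstep p)),
      hasPlateaus_tsum hN (hstep p)⟩⟩

end Potential

/-! ### Summation over blocks -/

section Blocks

open Filter Topology

theorem summable_of_le_on_finsets {α : Type*} {f : α → ℝ} (hf : ∀ a, 0 ≤ f a)
    {I : ℕ → Finset α} {u : ℕ → ℝ} (hu0 : ∀ k, 0 ≤ u k) (hu : Summable fun k => (I k).card * u k)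
    (hfu : ∀ᶠ a in cofinite, ∃ k, a ∈ I k ∧ f a ≤ u k) : Summable f := by
  obtain ⟨k, hk⟩ := skolem.1 hfu
  let g (i : ℕ × α) : ℝ := (I i.1 : Set α).indicator (fun _ => u i.1) i.2
  have hg0 : 0 ≤ g := fun i => Set.indicator_nonneg (fun _ _ => hu0 i.1) i.2
  have hsection (l : ℕ) : HasSum (fun a => g (l, a)) ((I l).card * u l) := by
    have h : HasSum (fun a => g (l, a)) (∑ a ∈ I l, g (l, a)) :=
      hasSum_sum_of_ne_finset_zero fun a ha => Set.indicator_of_notMem ha _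
    have hconst : ∀ a ∈ I l, g (l, a) = u l := fun a ha => Set.indicator_of_mem ha _
    rwa [Finset.sum_congr rfl hconst, Finset.sum_const, nsmul_eq_mul] at h
  have hg : Summable g := (summable_prod_of_nonneg hg0).2
    ⟨fun l => (hsection l).summable, hu.congr fun l => (hsection l).tsum_eq.symm⟩
  have hinj : Function.Injective fun a => (k a, a) := fun a b h => congrArg Prod.snd h
  refine .of_norm_bounded_eventually (hg.comp_injective hinj) (hk.mono fun a ha => ?_)
  rw [Real.norm_of_nonneg (hf a)]
  have hga : g (k a, a) = u (k a) := Set.indicator_of_mem (Finset.mem_coe.2 ha.1) _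
  exact ha.2.trans_eq hga.symm

variable {f : ℤ → ℝ} {N : ℕ → ℕ}

theorem eventually_exists_mem_block (hN : StrictMono N) (k₀ : ℕ) :
    ∀ᶠ n : ℤ in cofinite, ∃ k ≥ k₀, 2 * N k ≤ n.natAbs ∧ n.natAbs ≤ 2 * N (k + 1) := by
  have hmono : StrictMono fun k => 2 * N k := hN.const_mul two_pos
  refine (Set.finite_Icc (-(2 * N k₀ : ℤ)) (2 * N k₀)).subset fun n hn => ?_
  by_contra hfar
  rw [Set.mem_Icc] at hfar
  have hk₀ : 2 * N k₀ < n.natAbs := by omega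
  obtain ⟨k, hk, hk'⟩ := hmono.exists_between_of_tendsto_atTop hmono.tendsto_atTop
    ((hmono.monotone k₀.zero_le).trans_lt hk₀)
  exact hn ⟨k, Nat.lt_succ_iff.1 (hmono.lt_iff_lt.1 (hk₀.trans_le hk')), hk.le, hk'⟩

theorem summable_of_le_on_blocks (hf : ∀ n, 0 ≤ f n) (hN : StrictMono N) {u : ℕ → ℝ}
    (hu0 : ∀ k, 0 ≤ u k) (hu : Summable fun k => N (k + 1) * u k)
    (hfu : ∀ᶠ k in atTop, ∀ n : ℤ, 2 * N k ≤ n.natAbs → n.natAbs ≤ 2 * N (k + 1) → f n ≤ u k) :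
    Summable f := by
  obtain ⟨k₀, hk₀⟩ := eventually_atTop.1 hfu
  refine summable_of_le_on_finsets (I := fun k => Finset.Icc (-(2 * N (k + 1) : ℤ)) (2 * N (k + 1)))
    hf hu0 ?_ ?_
  · refine .of_nonneg_of_le (fun k => by have := hu0 k; positivity) (fun k => ?_) (hu.mul_left 5)
    rw [← mul_assoc]
    refine mul_le_mul_of_nonneg_right ?_ (hu0 k)
    have hpos : 0 < N (k + 1) := (Nat.zero_le _).trans_lt (hN k.lt_succ_self)
    exact_mod_cast (by rw [Int.card_Icc]; omega :
      (Finset.Icc (-(2 * N (k + 1) : ℤ)) (2 * N (k + 1))).card ≤ 5 * N (k + 1))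
  · filter_upwards [eventually_exists_mem_block hN k₀] with n ⟨k, hk, hn, hn'⟩
    exact ⟨k, by rw [Finset.mem_Icc]; omega, hk₀ k hk n hn hn'⟩

theorem not_summable_of_le_on_blocks (hN : StrictMono N) (hN4 : ∀ k, 4 * N k ≤ N (k + 1))
    (hf : ∀ᶠ k in atTop, ∀ n : ℤ, 2 * N k ≤ n.natAbs → n.natAbs ≤ N (k + 1) →
      (N (k + 1) : ℝ)⁻¹ ≤ f n) : ¬ Summable f := by
  intro hsum
  have hpartial := (hsum.comp_injective Nat.cast_injective).hasSum.tendsto_sum_nat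
  have hblock : Tendsto (fun k => ∑ n ∈ Finset.Ico (2 * N k) (N (k + 1)), f n) atTop (𝓝 0) := by
    have hsub := (hpartial.comp (hN.tendsto_atTop.comp (tendsto_add_atTop_nat 1))).sub
      (hpartial.comp (hN.const_mul two_pos).tendsto_atTop)
    rw [sub_self] at hsub
    exact hsub.congr fun k =>
      (Finset.sum_Ico_eq_sub _ (by have := hN4 k; omega : 2 * N k ≤ N (k + 1))).symm
  have hhalf : ∀ᶠ k in atTop, 1 / 2 ≤ ∑ n ∈ Finset.Ico (2 * N k) (N (k + 1)), f n := by
    filter_upwards [hf] with k hk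
    have hpos : (0 : ℝ) < N (k + 1) := by
      exact_mod_cast (Nat.zero_le _).trans_lt (hN k.lt_succ_self)
    have hcard : (N (k + 1) : ℝ) ≤ 2 * (Finset.Ico (2 * N k) (N (k + 1))).card := by
      have := hN4 k
      exact_mod_cast (by rw [Nat.card_Ico]; omega :
        N (k + 1) ≤ 2 * (Finset.Ico (2 * N k) (N (k + 1))).card)
    calc (1 / 2 : ℝ) ≤ (Finset.Ico (2 * N k) (N (k + 1))).card * (N (k + 1) : ℝ)⁻¹ := by
          rw [← div_eq_mul_inv, div_le_div_iff₀ two_pos hpos]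
          linarith
      _ ≤ ∑ n ∈ Finset.Ico (2 * N k) (N (k + 1)), f n := by
          rw [← nsmul_eq_mul]
          refine Finset.card_nsmul_le_sum _ _ _ fun n hn => ?_
          rw [Finset.mem_Ico] at hn
          exact hk n (by omega) (by omega)
  exact absurd (ge_of_tendsto hblock hhalf) (by norm_num)

end Blocks

/-! ### The critical exponent -/

section Scales

open Filter Topology

/-- The scales of the plateaus: on the block where `|n|` is of order `radius (k + 1)`, the
quantity `log |n|` is of order `scale k ^ 4`. -/
def scale (k : ℕ) : ℕ := 2 ^ 2 ^ k

theorem scale_succ (k : ℕ) : scale (k + 1) = scale k ^ 2 := by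
  rw [scale, scale, pow_succ, pow_mul]

theorem scale_strictMono : StrictMono scale :=
  (pow_right_strictMono₀ one_lt_two).comp (pow_right_strictMono₀ one_lt_two)

theorem two_le_scale (k : ℕ) : 2 ≤ scale k := scale_strictMono.monotone k.zero_le

theorem tendsto_scale_atTop : Tendsto (fun k => (scale k : ℝ)) atTop atTop :=
  tendsto_natCast_atTop_atTop.comp scale_strictMono.tendsto_atTop

/-- The block boundaries `⌈exp (scale k ^ 2)⌉₊ = ⌈exp (scale (k + 1))⌉₊`. -/
noncomputable def radius (k : ℕ) : ℕ := ⌈Real.exp (scale k ^ 2)⌉₊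

theorem exp_le_radius (k : ℕ) : Real.exp (scale k ^ 2) ≤ radius k := Nat.le_ceil _

theorem radius_le (k : ℕ) : (radius k : ℝ) ≤ 2 * Real.exp (scale k ^ 2) := by
  have hone : (1 : ℝ) ≤ Real.exp (scale k ^ 2) := Real.one_le_exp (sq_nonneg _)
  have hceil : (radius k : ℝ) < Real.exp (scale k ^ 2) + 1 :=
    Nat.ceil_lt_add_one (Real.exp_pos _).le
  linarith

theorem radius_pos (k : ℕ) : 0 < radius k := Nat.ceil_pos.2 (Real.exp_pos _)

theorem four_mul_radius_le (k : ℕ) : 4 * radius k ≤ radius (k + 1) := by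
  have hz : (4 : ℝ) ≤ scale k ^ 2 := by exact_mod_cast Nat.pow_le_pow_left (two_le_scale k) 2
  have h8 : (8 : ℝ) ≤ Real.exp 8 := by linarith [Real.add_one_le_exp 8]
  have hreal : (4 * radius k : ℝ) ≤ radius (k + 1) :=
    calc (4 * radius k : ℝ) ≤ 8 * Real.exp (scale k ^ 2) := by linarith [radius_le k]
      _ ≤ Real.exp 8 * Real.exp (scale k ^ 2) :=
          mul_le_mul_of_nonneg_right h8 (Real.exp_pos _).le
      _ = Real.exp (8 + scale k ^ 2) := (Real.exp_add _ _).symm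
      _ ≤ Real.exp (scale (k + 1) ^ 2) := by
          rw [scale_succ, Nat.cast_pow]
          exact Real.exp_le_exp.2 (by nlinarith)
      _ ≤ radius (k + 1) := exp_le_radius _
  exact_mod_cast hreal

theorem radius_strictMono : StrictMono radius := strictMono_nat_of_lt_succ fun k => by
  have := radius_pos k
  have := four_mul_radius_le k
  omega

theorem summable_scale_pow_div_radius : Summable fun k => (scale k : ℝ) ^ 4 / radius k := by
  refine .of_nonneg_of_le (fun k => by positivity) (fun k => ?_)
    ((Real.summable_pow_mul_exp_neg_nat_mul 2 one_pos).comp_injective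
      (scale_strictMono.injective.comp (add_left_injective 1)))
  rw [div_le_iff₀ (by exact_mod_cast radius_pos k)]
  calc (scale k : ℝ) ^ 4 = (scale k ^ 2) ^ 2 * (Real.exp (-1 * scale k ^ 2) *
        Real.exp (scale k ^ 2)) := by
        rw [← Real.exp_add, neg_one_mul, neg_add_cancel, Real.exp_zero, mul_one, ← pow_mul]
    _ ≤ (scale k ^ 2) ^ 2 * (Real.exp (-1 * scale k ^ 2) * radius k) := by
        gcongr
        exact exp_le_radius k
    _ = _ := by simp only [Function.comp_apply, scale_succ, Nat.cast_pow, mul_assoc]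

theorem sum_scale_pow_le (k : ℕ) :
    ∑ i ∈ Finset.range k, (scale i : ℝ) ^ 4 ≤ 2 * scale k ^ 2 := by
  induction k with
  | zero => simp only [Finset.range_zero, Finset.sum_empty]; positivity
  | succ k ih =>
    have hz : (4 : ℝ) ≤ scale k ^ 2 := by exact_mod_cast Nat.pow_le_pow_left (two_le_scale k) 2
    rw [Finset.sum_range_succ, scale_succ, Nat.cast_pow]
    nlinarith

/-- The height of the plateaus on the block ending at `radius (k + 1)`. The main term `γ log |n|`
fixes the critical exponent `-γ⁻¹`; the lower-order term, which dominates the error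
`O(scale k ^ 2)` of the construction, decides by the sign of `σ` whether the exponent is
attained. -/
noncomputable def plateauHeight (γ σ : ℝ) (k : ℕ) : ℝ := γ * (scale k ^ 4 + σ * scale k ^ 3)

theorem plateauHeight_mem_Icc {γ σ : ℝ} (hγ : 0 ≤ γ) (hσ : |σ| ≤ 1) (k : ℕ) :
    plateauHeight γ σ k ∈ Set.Icc 0 (2 * γ * scale k ^ 4) := by
  have hz : (1 : ℝ) ≤ scale k := by exact_mod_cast one_le_two.trans (two_le_scale k)
  have hz3 : (scale k : ℝ) ^ 3 ≤ scale k ^ 4 := pow_le_pow_right₀ hz (by norm_num)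
  have hlower : |σ * scale k ^ 3| ≤ scale k ^ 4 := by
    rw [abs_mul, abs_of_nonneg (by positivity : (0 : ℝ) ≤ scale k ^ 3)]
    exact (mul_le_of_le_one_left (by positivity) hσ).trans hz3
  rw [abs_le] at hlower
  refine ⟨mul_nonneg hγ (by linarith), ?_⟩
  rw [mul_comm 2 γ, mul_assoc]
  exact mul_le_mul_of_nonneg_left (by linarith) hγ

theorem HasPlateaus.mono {N : ℕ → ℕ} {a B C : ℕ → ℝ} {s : ℤ → ℝ} (hs : HasPlateaus N a B s)
    (hBC : ∀ k, B k ≤ C k) : HasPlateaus N a C s where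
  sub_le k n hn hn' := (sub_le_sub_left (hBC k) _).trans (hs.sub_le k n hn hn')
  le_add k n hn hn' := (hs.le_add k n hn hn').trans (add_le_add_right (hBC k) _)

theorem exists_potential {X : Type u} [TopologicalSpace X] [CompactSpace X] [T2Space X]
    {φ : X ≃ₜ X} {κ : Type*} [Finite κ] {x : κ → X} (hx : ∀ p, x p ∉ Function.periodicPts φ)
    (hdisj : Pairwise (Function.onFun Disjoint fun p => homeoOrbit φ (x p)))
    {γ σ : κ → ℝ} (hγ : ∀ p, 0 ≤ γ p) (hσ : ∀ p, |σ p| ≤ 1) :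
    ∃ F ∈ closure (Set.range (coboundary φ)), ∃ D : ℝ, ∀ p, ∃ s, IsOrbitPrimitive φ F (x p) s ∧
      HasPlateaus radius (plateauHeight (γ p) (σ p)) (fun k => D * scale k ^ 2) s := by
  obtain ⟨C, hC, hγC⟩ : ∃ C : ℝ, 0 ≤ C ∧ ∀ p, 2 * γ p ≤ C := by
    obtain ⟨Γ, hΓ⟩ := (Set.finite_range fun p => 2 * γ p).bddAbove
    exact ⟨max 0 Γ, le_max_left _ _, fun p => le_max_of_le_right (hΓ (Set.mem_range_self p))⟩
  have hheight (p : κ) (k : ℕ) : plateauHeight (γ p) (σ p) k ≤ C * scale k ^ 4 :=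
    (plateauHeight_mem_Icc (hγ p) (hσ p) k).2.trans
      (mul_le_mul_of_nonneg_right (hγC p) (by positivity))
  have hsummable : Summable fun k => C * (scale k : ℝ) ^ 4 / radius k := by
    simpa only [mul_div_assoc] using summable_scale_pow_div_radius.mul_left C
  obtain ⟨F, hF, hs⟩ := exists_potential_of_scales hx hdisj radius_strictMono (radius_pos 0)
    (fun k => by positivity) hsummable (fun p k => (plateauHeight_mem_Icc (hγ p) (hσ p) k).1)
    hheight
  refine ⟨F, hF, C * 2, fun p => ?_⟩
  obtain ⟨s, hs, hplateaus⟩ := hs p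
  refine ⟨s, hs, hplateaus.mono fun k => ?_⟩
  rw [← Finset.mul_sum, mul_assoc]
  exact mul_le_mul_of_nonneg_left (sum_scale_pow_le k) hC

end Scales

section CriticalExponent

open Filter Topology

theorem tendsto_quadratic_atTop {A B : ℝ} (h : 0 < A ∨ A = 0 ∧ 0 < B) (D : ℝ) :
    Tendsto (fun z : ℝ => A * z ^ 2 + B * z + D) atTop atTop := by
  refine tendsto_atTop_add_const_right _ D ?_
  rcases h with hA | ⟨rfl, hB⟩
  · have hlin : Tendsto (fun z : ℝ => A * z + B) atTop atTop :=
      tendsto_atTop_add_const_right _ B (tendsto_id.const_mul_atTop hA)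
    exact (hlin.atTop_mul_atTop₀ tendsto_id).congr fun z => by simp only [id]; ring
  · simpa only [zero_mul, zero_add, id_eq] using tendsto_id.const_mul_atTop hB

theorem eventually_le_quadratic_scale {A B : ℝ} (h : 0 < A ∨ A = 0 ∧ 0 < B) (D r : ℝ) :
    ∀ᶠ k in atTop, r ≤ A * (scale k : ℝ) ^ 2 + B * scale k + D :=
  ((tendsto_quadratic_atTop h D).comp tendsto_scale_atTop).eventually_ge_atTop r

variable {β γ σ D : ℝ} {s : ℤ → ℝ}

theorem HasPlateaus.summable_exp
    (hs : HasPlateaus radius (plateauHeight γ σ) (fun k => D * scale k ^ 2) s) (hβ : β ≤ 0)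
    (h : 1 < -(β * γ) ∨ -(β * γ) = 1 ∧ 0 < σ) : Summable fun n => Real.exp (β * s n) := by
  have hcoeff : 0 < -(β * γ) - 1 ∨ -(β * γ) - 1 = 0 ∧ 0 < -(β * γ) * σ := by
    rcases h with h | ⟨h, hσ⟩
    · exact .inl (sub_pos.2 h)
    · exact .inr ⟨sub_eq_zero.2 h, by rwa [h, one_mul]⟩
  refine summable_of_le_on_blocks (fun n => (Real.exp_pos _).le) radius_strictMono
    (u := fun k => Real.exp (β * (plateauHeight γ σ k - D * scale k ^ 2)))
    (fun k => (Real.exp_pos _).le) ?_ (.of_forall fun k n hn hn' =>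
      Real.exp_le_exp.2 (mul_le_mul_of_nonpos_left (hs.sub_le k n hn hn') hβ))
  refine .of_norm_bounded_eventually_nat (Real.summable_exp_neg_nat.mul_left 2) ?_
  filter_upwards [eventually_le_quadratic_scale hcoeff (β * D) 1] with k hk
  have hz : (1 : ℝ) ≤ scale k := by exact_mod_cast one_le_two.trans (two_le_scale k)
  have hkz : (k : ℝ) ≤ scale k := by exact_mod_cast scale_strictMono.id_le k
  rw [Real.norm_of_nonneg (by positivity)]
  calc radius (k + 1) * Real.exp (β * (plateauHeight γ σ k - D * scale k ^ 2))
      ≤ 2 * Real.exp (scale (k + 1) ^ 2) *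
          Real.exp (β * (plateauHeight γ σ k - D * scale k ^ 2)) := by
        gcongr
        exact radius_le _
    _ = 2 * Real.exp (-(scale k ^ 2 *
          ((-(β * γ) - 1) * scale k ^ 2 + -(β * γ) * σ * scale k + β * D))) := by
        rw [mul_assoc, ← Real.exp_add, scale_succ, Nat.cast_pow, plateauHeight]
        ring_nf
    _ ≤ 2 * Real.exp (-k) := by
        gcongr
        nlinarith

theorem HasPlateaus.not_summable_exp
    (hs : HasPlateaus radius (plateauHeight γ σ) (fun k => D * scale k ^ 2) s)
    (h : -(β * γ) < 1 ∨ -(β * γ) = 1 ∧ σ < 0) : ¬ Summable fun n => Real.exp (β * s n) := by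
  have hcoeff : 0 < 1 - -(β * γ) ∨ 1 - -(β * γ) = 0 ∧ 0 < -(-(β * γ) * σ) := by
    rcases h with h | ⟨h, hσ⟩
    · exact .inl (sub_pos.2 h)
    · exact .inr ⟨sub_eq_zero.2 h.symm, by rwa [h, one_mul, neg_pos]⟩
  refine not_summable_of_le_on_blocks radius_strictMono four_mul_radius_le ?_
  filter_upwards [eventually_le_quadratic_scale hcoeff (-(|β| * D)) 0] with k hk n hn hn'
  have hdist : |s n - plateauHeight γ σ k| ≤ D * scale k ^ 2 :=
    abs_sub_le_iff.2 ⟨sub_le_iff_le_add'.2 (hs.le_add k n hn hn'),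
      sub_le_comm.1 (hs.sub_le k n hn (by omega))⟩
  have hβ : -(|β| * (D * scale k ^ 2)) ≤ β * (s n - plateauHeight γ σ k) := by
    refine (neg_le_neg ?_).trans (neg_abs_le _)
    rw [abs_mul]
    exact mul_le_mul_of_nonneg_left hdist (abs_nonneg β)
  calc (radius (k + 1) : ℝ)⁻¹ ≤ (Real.exp (scale (k + 1) ^ 2))⁻¹ :=
        inv_anti₀ (Real.exp_pos _) (exp_le_radius _)
    _ = Real.exp (-(scale k ^ 2) ^ 2) := by
        rw [← Real.exp_neg, scale_succ, Nat.cast_pow]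
    _ ≤ Real.exp (β * s n) := by
        rw [plateauHeight] at hβ
        refine Real.exp_le_exp.2 ?_
        nlinarith [mul_nonneg (sq_nonneg (scale k : ℝ)) hk]

theorem HasPlateaus.summable_exp_iff {β₀ : ℝ} (hβ₀ : β₀ < 0)
    (hs : HasPlateaus radius (plateauHeight (-β₀)⁻¹ σ) (fun k => D * scale k ^ 2) s)
    (hσ : σ ≠ 0) : (Summable fun n => Real.exp (β * s n)) ↔ β < β₀ ∨ β = β₀ ∧ 0 < σ := by
  have hratio : -(β * (-β₀)⁻¹) = β / β₀ := by rw [inv_neg, mul_neg, neg_neg, div_eq_mul_inv]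
  refine ⟨fun hsum => ?_, fun h => hs.summable_exp ?_ ?_⟩
  · by_contra! hcon
    refine hs.not_summable_exp ?_ hsum
    rw [hratio, div_lt_one_of_neg hβ₀, div_eq_one_iff_eq hβ₀.ne]
    exact hcon.1.lt_or_eq.imp id fun h => ⟨h.symm, (hcon.2 h.symm).lt_of_ne hσ⟩
  · rcases h with h | ⟨rfl, -⟩
    · exact (h.trans hβ₀).le
    · exact hβ₀.le
  · rwa [hratio, one_lt_div_of_neg hβ₀, div_eq_one_iff_eq hβ₀.ne]

end CriticalExponent

theorem mem_iff_of_eq_Iic_or_eq_Iio {α : Type*} [PartialOrder α] {J : Set α} {b : α}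
    (hJ : J = Set.Iic b ∨ J = Set.Iio b) (a : α) : a ∈ J ↔ a < b ∨ a = b ∧ b ∈ J := by
  rcases hJ with rfl | rfl
  · simp only [Set.mem_Iic, le_refl, and_true, le_iff_lt_or_eq]
  · simp only [Set.mem_Iio, lt_irrefl, and_false, or_false]

theorem theorem7p1_general {X : Type u} [TopologicalSpace X] [CompactSpace X] [T2Space X]
    [MeasurableSpace X] [BorelSpace X] (φ : X ≃ₜ X) {κ : Type*} [Finite κ] (x : κ → X)
    (hx : ∀ p, x p ∉ Function.periodicPts φ)
    (hdisj : Pairwise (Function.onFun Disjoint fun p => homeoOrbit φ (x p)))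
    (β₀ : κ → ℝ) (hβ₀ : ∀ p, β₀ p < 0)
    (J : κ → Set ℝ) (hJ : ∀ p, J p = Set.Iic (β₀ p) ∨ J p = Set.Iio (β₀ p)) :
    ∃ F : C(X, ℝ),
      (∀ (p : κ) (β : ℝ),
        (∃ m : MeasureTheory.Measure X,
          IsConformalMeasure φ F β m ∧ IsConcentratedOn m (homeoOrbit φ (x p))) ↔ β ∈ J p) ∧
      (potentialFlow φ F).IsApproximatelyInner := by
  classical
  let σ (p : κ) : ℝ := if β₀ p ∈ J p then 1 else -1
  have hσ (p : κ) : |σ p| = 1 ∧ (0 < σ p ↔ β₀ p ∈ J p) := by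
    by_cases h : β₀ p ∈ J p <;> simp [σ, h]
  obtain ⟨F, hF, D, hs⟩ := exists_potential hx hdisj
    (fun p => inv_nonneg.2 (neg_nonneg.2 (hβ₀ p).le)) fun p => (hσ p).1.le
  refine ⟨F, fun p β => ?_, potentialFlow_isApproximatelyInner_of_mem_closure φ hF⟩
  obtain ⟨s, hs, hplateaus⟩ := hs p
  have hσ0 : σ p ≠ 0 := abs_pos.1 ((hσ p).1 ▸ one_pos)
  rw [exists_isConformalMeasure_iff_summable (hx p) hs, hplateaus.summable_exp_iff (hβ₀ p) hσ0,
    mem_iff_of_eq_Iic_or_eq_Iio (hJ p), (hσ p).2]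

theorem theorem7p1 {X : Type u} [MetricSpace X] [CompactSpace X] [MeasurableSpace X]
    [BorelSpace X] (φ : X ≃ₜ X) (q : ℕ) (x : Fin q → X)
    (hx : ∀ p, x p ∉ Function.periodicPts φ)
    (hdisj : ∀ p p' : Fin q, p ≠ p' → Disjoint (homeoOrbit φ (x p)) (homeoOrbit φ (x p')))
    (β₀ : Fin q → ℝ) (hβ₀ : ∀ p, β₀ p < 0)
    (J : Fin q → Set ℝ) (hJ : ∀ p, J p = Set.Iic (β₀ p) ∨ J p = Set.Iio (β₀ p)) :
    ∃ F : C(X, ℝ),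
      (∀ (p : Fin q) (β : ℝ),
        (∃ m : MeasureTheory.Measure X,
          IsConformalMeasure φ F β m ∧ IsConcentratedOn m (homeoOrbit φ (x p))) ↔ β ∈ J p) ∧
      (potentialFlow φ F).IsApproximatelyInner :=
  theorem7p1_general φ x hx (fun p p' => hdisj p p') β₀ hβ₀ J hJ
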